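/- **Theorem 3.4.** Let $(R,\mathfrak m)$ be a commutative Noetherian local ring, let $X$ be an Artinian $R$-module with $\operatorname{N.dim}_R X=d\ge 0$ (so $X\neq 0$), and let $\underline x=(x_1,\dots,x_d)$ be a sequence of elements of $\mathfrak m$ such that $0:_X\underline x=\{y\in X : x_1y=\dots=x_dy=0\}$ has finite length. If $X$ is co-Cohen–Macaulay, then there is an isomorphism of $R$-modules $$H^d_{\underline x}\bigl(H_d^{\underline x}(X)\bigr)\;\cong\; X .$$ Here: * $H^i_{\underline x}(N)=\varinjlim_n \operatorname{Ext}^i_R\bigl(R/(x_1,\dots,x_d)^n,N\bigr)$ is the $i$-th local cohomology module of $N$ with support in the ideal $(x_1,\dots,x_d)$. * $H_i^{\underline x}(X)=\varprojlim_{n\ge 1} H_i\bigl(K_\bullet(x_1^n,\dots,x_d^n;X)\bigr)$ is the $i$-th local homology module, where $K_\bullet(x_1^n,\dots,x_d^n;X)$ is the Koszul complex of $X$ and the transition maps are induced by the chain maps $K_\bullet(x_1^{n+1},\dots,x_d^{n+1};X)\to K_\bullet(x_1^n,\dots,x_d^n;X)$, $e_{i_1}\wedge\dots\wedge e_{i_p}\mapsto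 x_{i_1}\cdots x_{i_p}\,e_{i_1}\wedge\dots\wedge e_{i_p}$. * The Noetherian dimension $\operatorname{N.dim}_R X$ is defined inductively: $\operatorname{N.dim}_R X=-1$ if $X=0$; for $r\ge 0$, $\operatorname{N.dim}_R X=r$ if $\operatorname{N.dim}_R X<r$ is false and for every ascending chain $X_0\subseteq X_1\subseteq\cdots$ of submodules of $X$ there is an $n$ with $\operatorname{N.dim}_R(X_{m+1}/X_m)<r$ for all $m\ge n$. * A sequence $y_1,\dots,y_l\in\mathfrak m$ is $X$-coregular if multiplication by $y_i$ maps $0:_X(y_1,\dots,y_{i-1})$ onto itself for $i=1,\dots,l$. The width of $X$ is the supremum of the lengths of $X$-coregular sequences in $\mathfrak m$, and the Artinian module $X$ is co-Cohen–Macaulay if its width equals $\operatorname{N.dim}_R X$. -/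

import Mathlib

open CategoryTheory CategoryTheory.Limits

universe u

/-! ### Noetherian dimension, coregular sequences, width, co-Cohen–Macaulay modules -/

/-- `NDimLT R r X` says `N.dim X < r`. The base case is `N.dim X < 0` (that is, `N.dim X = -1`)
iff `X = 0`; and `N.dim X < r + 1` iff `N.dim X < r`, or every ascending chain
`X₀ ⊆ X₁ ⊆ ⋯` of submodules of `X` satisfies `N.dim (Xₘ₊₁ / Xₘ) < r` for all large `m`. -/
def NDimLT (R : Type u) [CommRing R] :
    ℕ → ∀ (X : Type u) [AddCommGroup X] [Module R X], Prop
  | 0, X, _, _ => Subsingleton X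
  | r + 1, X, _, _ => NDimLT R r X ∨
      ∀ C : ℕ →o Submodule R X, ∃ n : ℕ, ∀ m : ℕ, n ≤ m →
        NDimLT R r (C (m + 1) ⧸ (C m).submoduleOf (C (m + 1)))

/-- The Noetherian dimension `N.dim X`, with `⊥` in the role of `-1` (the value at `X = 0`). -/
noncomputable def nDim (R : Type u) [CommRing R] (X : Type u) [AddCommGroup X] [Module R X] :
    WithBot ℕ∞ :=
  sInf {n : WithBot ℕ∞ | ∀ r : ℕ, n < (r : WithBot ℕ∞) → NDimLT R r X}

/-- `x₁, …, xₙ` is an `X`-coregular sequence: for each `i`, multiplication by `xᵢ` maps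
`0 :_X (x₁, …, xᵢ₋₁)` onto itself. -/
def IsCoregularSeq {R : Type u} [CommRing R] (X : Type u) [AddCommGroup X] [Module R X]
    {n : ℕ} (x : Fin n → R) : Prop :=
  ∀ i : Fin n, Set.SurjOn (fun y : X => x i • y)
    (Submodule.torsionBySet R X (x '' Set.Iio i)) (Submodule.torsionBySet R X (x '' Set.Iio i))

/-- The width of `X`: the supremum of the lengths of the `X`-coregular sequences in the
maximal ideal of the local ring `R`. -/
noncomputable def moduleWidth (R : Type u) [CommRing R] [IsLocalRing R]
    (X : Type u) [AddCommGroup X] [Module R X] : ℕ∞ :=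
  sSup {l : ℕ∞ | ∃ (n : ℕ) (y : Fin n → R), (∀ i, y i ∈ IsLocalRing.maximalIdeal R) ∧
    IsCoregularSeq X y ∧ l = n}

/-- `X` is co-Cohen–Macaulay: it is Artinian and its width equals its Noetherian dimension. -/
def IsCoCohenMacaulay (R : Type u) [CommRing R] [IsLocalRing R]
    (X : Type u) [AddCommGroup X] [Module R X] : Prop :=
  IsArtinian R X ∧ (moduleWidth R X : WithBot ℕ∞) = nDim R X

/-! ### The Koszul complex and local homology -/

namespace KoszulComplex

variable {R : Type u} [CommRing R] {r : ℕ}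

/-- The basis of `⋀ᵖ R^r`: the `p`-element subsets of `{1, …, r}`. -/
abbrev Idx (r p : ℕ) : Type := {s : Finset (Fin r) // s.card = p}

/-- `s ∪ {i}` for `i ∉ s`. -/
def Idx.insert {p : ℕ} (s : Idx r p) (i : {i : Fin r // i ∉ s.1}) : Idx r (p + 1) :=
  ⟨Insert.insert i.1 s.1, by rw [Finset.card_insert_of_notMem i.2, s.2]⟩

/-- The sign of `e_s` in the boundary of `e_{s ∪ {i}}`. -/
def sgn (s : Finset (Fin r)) (i : Fin r) : R := (-1) ^ (s.filter (· < i)).card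

lemma sgn_insert_of_lt (s : Finset (Fin r)) {i j : Fin r} (hi : i ∉ s) (h : i < j) :
    (sgn (insert i s) j : R) = - sgn s j := by
  unfold sgn
  rw [Finset.filter_insert, if_pos h, Finset.card_insert_of_notMem (by simp [hi]), pow_succ]
  ring

lemma sgn_insert_of_gt (s : Finset (Fin r)) {i j : Fin r} (h : j < i) :
    (sgn (insert i s) j : R) = sgn s j := by
  unfold sgn
  rw [Finset.filter_insert, if_neg (not_lt.mpr h.le)]

/-- The Koszul differential `K_{p+1} → K_p`, where the chain `f` stands for `∑ₛ f(s) eₛ`. It is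
`f(s) e_s ↦ ∑_{i ∈ s} (-1)^{#{j ∈ s, j < i}} xᵢ f(s) e_{s \ {i}}`,
written out by its coefficients. -/
def dLin (x : Fin r → R) (X : Type u) [AddCommGroup X] [Module R X] (p : ℕ) :
    (Idx r (p + 1) → X) →ₗ[R] (Idx r p → X) where
  toFun f s := ∑ i : {i : Fin r // i ∉ s.1}, (sgn s.1 i.1 * x i.1) • f (s.insert i)
  map_add' f g := by
    funext s
    simp [smul_add, Finset.sum_add_distrib]
  map_smul' a f := by
    funext s
    simp only [Pi.smul_apply, RingHom.id_apply, Finset.smul_sum]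
    exact Finset.sum_congr rfl fun i _ => smul_comm _ _ _

lemma dLin_comp (x : Fin r → R) (X : Type u) [AddCommGroup X] [Module R X] (p : ℕ) :
    (dLin x X p).comp (dLin x X (p + 1)) = 0 := by
  refine LinearMap.ext fun f => funext fun s => ?_
  change ∑ i : {i : Fin r // i ∉ s.1}, (sgn s.1 i.1 * x i.1) •
    ∑ j : {j : Fin r // j ∉ (s.insert i).1},
      (sgn (s.insert i).1 j.1 * x j.1) • f ((s.insert i).insert j) = 0
  simp only [Finset.smul_sum, smul_smul]
  rw [Finset.sum_sigma']
  have hne : ∀ a : (Σ i : {i : Fin r // i ∉ s.1}, {j : Fin r // j ∉ (s.insert i).1}),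
      a.2.1 ≠ a.1.1 ∧ a.2.1 ∉ s.1 := fun a => by
    have := a.2.2
    simp only [Idx.insert, Finset.mem_insert, not_or] at this
    exact this
  refine Finset.sum_involution
    (fun a _ => ⟨⟨a.2.1, (hne a).2⟩, ⟨a.1.1, by
      simp only [Idx.insert, Finset.mem_insert, not_or]
      exact ⟨(hne a).1.symm, a.1.2⟩⟩⟩) ?_ ?_ ?_ ?_
  · rintro ⟨⟨i, hi⟩, ⟨j, hj⟩⟩ -
    have hj' : j ≠ i ∧ j ∉ s.1 := hne ⟨⟨i, hi⟩, ⟨j, hj⟩⟩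
    have hf : ∀ t t' : Idx r (p + 1 + 1), t.1 = t'.1 → f t = f t' :=
      fun t t' h => congrArg f (Subtype.ext h)
    rw [hf (Idx.insert (Idx.insert s ⟨j, hj'.2⟩) ⟨i, _⟩) (Idx.insert (Idx.insert s ⟨i, hi⟩) ⟨j, hj⟩)
      (Finset.insert_comm _ _ _), ← add_smul]
    convert zero_smul R _
    simp only [Idx.insert]
    rcases lt_or_gt_of_ne hj'.1 with h | h
    · rw [sgn_insert_of_gt s.1 h, sgn_insert_of_lt s.1 hj'.2 h]
      ring
    · rw [sgn_insert_of_lt s.1 hi h, sgn_insert_of_gt s.1 h]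
      ring
  · intro a _ _ h
    exact (hne a).1 (congrArg (fun b => b.1.1) h)
  · intro a _
    simp
  · intro a _
    rfl

/-- The Koszul complex `K.(x₁, …, x_r; X)`. -/
noncomputable def koszul (x : Fin r → R) (X : Type u) [AddCommGroup X] [Module R X] :
    ChainComplex (ModuleCat.{u} R) ℕ :=
  ChainComplex.of (fun p => ModuleCat.of R (Idx r p → X))
    (fun p => ModuleCat.ofHom (dLin x X p))
    (fun p => by rw [← ModuleCat.ofHom_comp, dLin_comp]; rfl)

/-- Degree `p` of the canonical chain map: `e_s ↦ (∏_{i ∈ s} xᵢ) e_s`. -/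
def transLin (x : Fin r → R) (X : Type u) [AddCommGroup X] [Module R X] (p : ℕ) :
    (Idx r p → X) →ₗ[R] (Idx r p → X) where
  toFun f s := (∏ i ∈ s.1, x i) • f s
  map_add' _ _ := funext fun _ => smul_add _ _ _
  map_smul' _ _ := funext fun _ => smul_comm _ _ _

lemma transLin_comm (x : Fin r → R) (X : Type u) [AddCommGroup X] [Module R X] (n p : ℕ) :
    (dLin (fun i => x i ^ n) X p).comp (transLin x X (p + 1)) =
      (transLin x X p).comp (dLin (fun i => x i ^ (n + 1)) X p) := by
  refine LinearMap.ext fun f => funext fun s => ?_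
  change ∑ i : {i : Fin r // i ∉ s.1}, (sgn s.1 i.1 * x i.1 ^ n) •
      (∏ j ∈ (s.insert i).1, x j) • f (s.insert i) =
    (∏ j ∈ s.1, x j) • ∑ i : {i : Fin r // i ∉ s.1},
      (sgn s.1 i.1 * x i.1 ^ (n + 1)) • f (s.insert i)
  rw [Finset.smul_sum]
  refine Finset.sum_congr rfl fun i _ => ?_
  rw [smul_smul, smul_smul]
  congr 1
  simp only [Idx.insert]
  rw [Finset.prod_insert i.2]
  ring

/-- The canonical chain map `K.(x₁ⁿ⁺¹, …, x_rⁿ⁺¹; X) → K.(x₁ⁿ, …, x_rⁿ; X)`, the identity in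
degree `0`, given by `eᵢ ↦ xᵢ eᵢ` in degree `1` and multiplicative. -/
noncomputable def trans (x : Fin r → R) (X : Type u) [AddCommGroup X] [Module R X] (n : ℕ) :
    koszul (fun i => x i ^ (n + 1)) X ⟶ koszul (fun i => x i ^ n) X :=
  ChainComplex.ofHom (fun p => ModuleCat.ofHom (transLin x X p)) (fun p => by
    simp only [koszul, ChainComplex.of_d]
    rw [← ModuleCat.ofHom_comp, ← ModuleCat.ofHom_comp, transLin_comm])

end KoszulComplex

/-- The inverse system `H_i(K.(x₁ⁿ, …, x_rⁿ; X))`, `n ≥ 1`; its `n`-th term (`n : ℕ`) has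
exponent `n + 1`. -/
noncomputable def koszulHomologySystem {R : Type u} [CommRing R] {r : ℕ} (x : Fin r → R)
    (X : Type u) [AddCommGroup X] [Module R X] (i : ℕ) : ℕᵒᵖ ⥤ ModuleCat.{u} R :=
  Functor.ofOpSequence (X := fun n => (KoszulComplex.koszul (fun j => x j ^ (n + 1)) X).homology i)
    (fun n => HomologicalComplex.homologyMap (KoszulComplex.trans x X (n + 1)) i)

/-- The local homology module `H_i^x(X) = lim_n H_i(K.(x₁ⁿ, …, x_rⁿ; X))`. -/
noncomputable def localHomology {R : Type u} [CommRing R] {r : ℕ} (x : Fin r → R)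
    (X : Type u) [AddCommGroup X] [Module R X] (i : ℕ) : ModuleCat.{u} R :=
  limit (koszulHomologySystem x X i)

/-! The top Koszul homology of `x₁ⁿ, …, x_dⁿ` on `X` is `0 :_X (x₁ⁿ, …, x_dⁿ)`, and the transition
maps become multiplication by `x₁ ⋯ x_d`. Hence top local homology is the module `torsionTower x X`
of compatible sequences in `X`, and it is peeled off one element at a time.

If `a` maps `X` onto itself, the sequences with `a • m (n + 1) = m n` form an extension of `X` by
`mulTowerKer a X`. Since `a` acts bijectively on the middle term, that term has no local cohomology
when `a ∈ J`, and the connecting map gives `H^(i+1)(mulTowerKer a X) ≅ H^i(X)`. A tower for `d`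
elements is a tower for `d - 1` of them over `mulTowerKer`, so `d` such shifts lead to `H⁰(X)`,
which is `X` because Artinian modules over a Noetherian local ring are torsion.

The iteration needs each `x j` to be surjective on the elements killed by any set of the others
(`IsStronglyCoregular`), a property that `mulTowerKer` inherits. On `X` it follows from depth
sensitivity: a coregular sequence of length `n` in the maximal ideal makes the Koszul complex of
`x`, or of powers of its members, exact below degree `n` (`exists_dLin_eq_of_isCoregularSeq`).
Exactness just below the top degree is then translated into surjectivity
(`exists_smul_eq_of_exact`). -/

/-! ### Dimension shifting for left derived functors and for `Ext` -/

namespace CategoryTheory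

section LeftDerived

universe v₁ u₁ v₂ u₂

variable {C : Type u₁} [Category.{v₁} C] [Abelian C] [HasProjectiveResolutions C]
  {D : Type u₂} [Category.{v₂} D] [Abelian D]
  {F G H : C ⥤ D} [F.Additive] [G.Additive] [H.Additive]

/-- The sequence of complexes obtained by applying a sequence of functors to a complex. -/
def mapComplexSequence (α : F ⟶ G) (β : G ⟶ H) (w : α ≫ β = 0) (K : ChainComplex C ℕ) :
    ShortComplex (ChainComplex D ℕ) :=
  ShortComplex.mk ((NatTrans.mapHomologicalComplex α _).app K)
    ((NatTrans.mapHomologicalComplex β _).app K) (by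
      ext n
      exact congr_app w (K.X n))

omit [HasProjectiveResolutions C] in
lemma mapComplexSequence_shortExact (α : F ⟶ G) (β : G ⟶ H) (w : α ≫ β = 0)
    (hex : ∀ (P : C) [Projective P],
      (ShortComplex.mk (α.app P) (β.app P) (by simpa using congr_app w P)).ShortExact)
    {A : C} (P : ProjectiveResolution A) :
    (mapComplexSequence α β w P.complex).ShortExact :=
  HomologicalComplex.shortExact_of_degreewise_shortExact _ fun i => hex (P.complex.X i)

/-- The connecting morphism on the homology of the complexes obtained by applying a short exact
sequence of functors to a projective resolution. -/
noncomputable def resolutionδ (α : F ⟶ G) (β : G ⟶ H) (w : α ≫ β = 0)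
    (hex : ∀ (P : C) [Projective P],
      (ShortComplex.mk (α.app P) (β.app P) (by simpa using congr_app w P)).ShortExact) (n : ℕ)
    {A : C} (P : ProjectiveResolution A) :
    (HomologicalComplex.homologyFunctor D _ (n + 1)).obj
        ((H.mapHomologicalComplex (ComplexShape.down ℕ)).obj P.complex) ⟶
      (HomologicalComplex.homologyFunctor D _ n).obj ((F.mapHomologicalComplex _).obj P.complex) :=
  (mapComplexSequence_shortExact α β w hex P).δ (n + 1) n (ComplexShape.down_mk _ _ rfl)

omit [HasProjectiveResolutions C] in
lemma resolutionδ_naturality (α : F ⟶ G) (β : G ⟶ H) (w : α ≫ β = 0)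
    (hex : ∀ (P : C) [Projective P],
      (ShortComplex.mk (α.app P) (β.app P) (by simpa using congr_app w P)).ShortExact) (n : ℕ)
    {A B : C} (P : ProjectiveResolution A) (Q : ProjectiveResolution B)
    (φ : P.complex ⟶ Q.complex) :
    resolutionδ α β w hex n P ≫
      (F.mapHomologicalComplex _ ⋙ HomologicalComplex.homologyFunctor _ _ n).map φ =
    (H.mapHomologicalComplex _ ⋙ HomologicalComplex.homologyFunctor _ _ (n + 1)).map φ ≫
      resolutionδ α β w hex n Q := by
  let Φ : mapComplexSequence α β w P.complex ⟶ mapComplexSequence α β w Q.complex :=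
    { τ₁ := (F.mapHomologicalComplex _).map φ
      τ₂ := (G.mapHomologicalComplex _).map φ
      τ₃ := (H.mapHomologicalComplex _).map φ
      comm₁₂ := by
        ext n; exact (α.naturality _)
      comm₂₃ := by
        ext n; exact (β.naturality _) }
  exact (HomologicalComplex.HomologySequence.δ_naturality Φ
    (mapComplexSequence_shortExact α β w hex P)
    (mapComplexSequence_shortExact α β w hex Q) (n + 1) n _)

/-- The connecting morphism of left derived functors. -/
noncomputable def leftDerivedδ (α : F ⟶ G) (β : G ⟶ H) (w : α ≫ β = 0)
    (hex : ∀ (P : C) [Projective P],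
      (ShortComplex.mk (α.app P) (β.app P) (by simpa using congr_app w P)).ShortExact) (n : ℕ) :
    H.leftDerived (n + 1) ⟶ F.leftDerived n where
  app A := ((projectiveResolution A).isoLeftDerivedObj H (n + 1)).hom ≫
    resolutionδ α β w hex n (projectiveResolution A) ≫
      ((projectiveResolution A).isoLeftDerivedObj F n).inv
  naturality A B f := by
    let φ := ProjectiveResolution.lift f (projectiveResolution A) (projectiveResolution B)
    have comm : φ.f 0 ≫ (projectiveResolution B).π.f 0 =
        (projectiveResolution A).π.f 0 ≫ f :=
      ProjectiveResolution.lift_commutes_zero _ _ _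
    rw [ProjectiveResolution.isoLeftDerivedObj_hom_naturality_assoc f _ _ φ comm H (n + 1),
      Category.assoc, Category.assoc,
      ProjectiveResolution.isoLeftDerivedObj_inv_naturality f _ _ φ comm F n]
    have := resolutionδ_naturality α β w hex n _ _ φ
    exact congrArg (_ ≫ ·) (((Category.assoc _ _ _).symm.trans
      (congrArg (· ≫ _) this.symm)).trans (Category.assoc _ _ _))

lemma isIso_leftDerivedδ_app (α : F ⟶ G) (β : G ⟶ H) (w : α ≫ β = 0)
    (hex : ∀ (P : C) [Projective P],
      (ShortComplex.mk (α.app P) (β.app P) (by simpa using congr_app w P)).ShortExact) (n : ℕ)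
    (A : C) (h₁ : IsZero ((G.leftDerived (n + 1)).obj A)) (h₀ : IsZero ((G.leftDerived n).obj A)) :
    IsIso ((leftDerivedδ α β w hex n).app A) := by
  have : IsIso (resolutionδ α β w hex n (projectiveResolution A)) :=
    ShortComplex.ShortExact.isIso_δ _ _ _ _
      (h₁.of_iso ((projectiveResolution A).isoLeftDerivedObj G (n + 1)).symm)
      (h₀.of_iso ((projectiveResolution A).isoLeftDerivedObj G n).symm)
  dsimp only [leftDerivedδ]
  infer_instance

end LeftDerived

end CategoryTheory

/-! ### Vanishing and connecting maps of `Ext` in the second variable. -/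

section Ext

variable {R : Type u} [CommRing R]

/-- The contravariant functor `Hom(-, Y)` as a functor to the opposite category. -/
noncomputable abbrev homOp (Y : ModuleCat.{u} R) : ModuleCat.{u} R ⥤ (ModuleCat.{u} R)ᵒᵖ :=
  ((linearYoneda R (ModuleCat.{u} R)).obj Y).rightOp

/-- The natural transformation `Hom(-, Z) ⟶ Hom(-, Y)` in the opposite category. -/
noncomputable abbrev homOpMap {Y Z : ModuleCat.{u} R} (f : Y ⟶ Z) : homOp Z ⟶ homOp Y :=
  NatTrans.rightOp ((linearYoneda R (ModuleCat.{u} R)).map f)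

lemma homOpMap_comp {Y Z W : ModuleCat.{u} R} (f : Y ⟶ Z) (g : Z ⟶ W) :
    homOpMap g ≫ homOpMap f = homOpMap (f ≫ g) := by
  rw [homOpMap, homOpMap, homOpMap, Functor.map_comp]
  rfl

lemma homOpMap_id (Y : ModuleCat.{u} R) : homOpMap (𝟙 Y) = 𝟙 (homOp Y) := by
  rw [homOpMap, CategoryTheory.Functor.map_id]
  rfl

/-- The scalar `a` induces the same endomorphism of `Ext` through either variable: through `L` it is
invertible, through `A` it is zero. An invertible zero map forces a zero object. -/
lemma isZero_leftDerived_homOp (a : R) (A L : ModuleCat.{u} R) (hA : a • 𝟙 A = 0)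
    (hL : IsIso (a • 𝟙 L)) (n : ℕ) : IsZero (((homOp L).leftDerived n).obj A) := by
  have hα : IsIso (NatTrans.leftDerived (homOpMap (a • 𝟙 L)) n) := by
    refine ⟨NatTrans.leftDerived (homOpMap (inv (a • 𝟙 L))) n, ?_, ?_⟩
    · rw [← NatTrans.leftDerived_comp, homOpMap_comp, IsIso.inv_hom_id, homOpMap_id,
        NatTrans.leftDerived_id]
    · rw [← NatTrans.leftDerived_comp, homOpMap_comp, IsIso.hom_inv_id, homOpMap_id,
        NatTrans.leftDerived_id]
  let P := projectiveResolution A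
  have h1 := P.leftDerived_app_eq (homOpMap (a • 𝟙 L)) n
  have h2 := (homOp L).leftDerived_map_eq n (a • 𝟙 A) (P := P) (Q := P) (a • 𝟙 P.complex) (by
    ext : 1
    let p : P.complex.X 0 ⟶ A := P.π.f 0
    change (a • 𝟙 (P.complex.X 0)) ≫ p = p ≫ (a • 𝟙 A)
    rw [Linear.smul_comp, Linear.comp_smul, Category.id_comp, Category.comp_id])
  -- Both `a • 𝟙` and `0` on the resolution lift `a • 𝟙 A = 0`, so they agree on derived functors.
  have h2' := (homOp L).leftDerived_map_eq n (a • 𝟙 A) (P := P) (Q := P) 0 (by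
    rw [hA, Functor.map_zero, comp_zero, zero_comp])
  have h3 : (NatTrans.leftDerived (homOpMap (a • 𝟙 L)) n).app A = 0 := by
    have : (NatTrans.mapHomologicalComplex (homOpMap (a • 𝟙 L)) (ComplexShape.down ℕ)).app
        P.complex = ((homOp L).mapHomologicalComplex _).map (a • 𝟙 P.complex) := by
      ext i
      apply Quiver.Hom.unop_inj
      ext (f : P.complex.X i ⟶ L)
      change f ≫ (a • 𝟙 L) = (a • 𝟙 (P.complex.X i)) ≫ f
      rw [Linear.smul_comp, Linear.comp_smul, Category.id_comp, Category.comp_id]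
    rw [h1, this]
    refine h2.symm.trans (h2'.trans ?_)
    rw [Functor.map_zero, zero_comp, comp_zero]
  have h4 : IsIso ((NatTrans.leftDerived (homOpMap (a • 𝟙 L)) n).app A) := inferInstance
  rw [h3] at h4
  exact ((isIsoZero_iff_source_target_isZero _ _).1 h4).1

lemma homOpMap_comp_eq_zero (S : ShortComplex (ModuleCat.{u} R)) :
    homOpMap S.g ≫ homOpMap S.f = 0 := by
  rw [homOpMap_comp, S.zero]
  ext P
  apply Quiver.Hom.unop_inj
  ext (f : P ⟶ S.X₁)
  exact (comp_zero : f ≫ (0 : S.X₁ ⟶ S.X₃) = 0)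

lemma homOp_shortExact (S : ShortComplex (ModuleCat.{u} R)) (hS : S.ShortExact)
    (P : ModuleCat.{u} R) [Projective P] :
    (ShortComplex.mk ((homOpMap S.g).app P) ((homOpMap S.f).app P)
      (congr_app (homOpMap_comp_eq_zero S) P)).ShortExact := by
  let T : ShortComplex (ModuleCat.{u} R) := ShortComplex.mk
    (((linearYoneda R (ModuleCat.{u} R)).map S.f).app (.op P))
    (((linearYoneda R (ModuleCat.{u} R)).map S.g).app (.op P)) (by
      ext (f : P ⟶ S.X₁)
      change (f ≫ S.f) ≫ S.g = 0
      rw [Category.assoc, S.zero, comp_zero])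
  have hT : T.ShortExact := by
    have := hS.mono_f
    have := hS.epi_g
    refine ShortComplex.ShortExact.mk' ?_ ?_ ?_
    · rw [ShortComplex.moduleCat_exact_iff]
      intro (f : P ⟶ S.X₂) (hf : f ≫ S.g = 0)
      exact ⟨hS.exact.lift f hf, hS.exact.lift_f f hf⟩
    · rw [ModuleCat.mono_iff_injective]
      intro (f : P ⟶ S.X₁) (g : P ⟶ S.X₁) (h : f ≫ S.f = g ≫ S.f)
      exact (cancel_mono S.f).1 h
    · rw [ModuleCat.epi_iff_surjective]
      intro (f : P ⟶ S.X₃)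
      exact ⟨Projective.factorThru f S.g, Projective.factorThru_comp f S.g⟩
  exact hT.op

/-- The connecting morphism `Ext^n(A, X₃) ⟶ Ext^(n + 1)(A, X₁)` of a short exact sequence, natural
in `A`. -/
noncomputable def extδ (S : ShortComplex (ModuleCat.{u} R)) (hS : S.ShortExact) (n : ℕ) :
    (Ext R (ModuleCat.{u} R) n).flip.obj S.X₃ ⟶ (Ext R (ModuleCat.{u} R) (n + 1)).flip.obj S.X₁ :=
  NatTrans.leftOp (leftDerivedδ (homOpMap S.g) (homOpMap S.f) (homOpMap_comp_eq_zero S)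
    (fun P _ => homOp_shortExact S hS P) n)

/-- Both neighbours of the connecting map in the long exact sequence are `Ext` modules with values
in `S.X₂`, and these vanish. -/
lemma isIso_extδ_app (S : ShortComplex (ModuleCat.{u} R)) (hS : S.ShortExact) (n : ℕ) (a : R)
    (hL : IsIso (a • 𝟙 S.X₂)) (A : (ModuleCat.{u} R)ᵒᵖ) (hA : a • 𝟙 A.unop = 0) :
    IsIso ((extδ S hS n).app A) := by
  have := isIso_leftDerivedδ_app (homOpMap S.g) (homOpMap S.f) (homOpMap_comp_eq_zero S)
    (fun P _ => homOp_shortExact S hS P) n A.unop (isZero_leftDerived_homOp a _ _ hA hL _)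
    (isZero_leftDerived_homOp a _ _ hA hL _)
  exact inferInstanceAs (IsIso ((leftDerivedδ (homOpMap S.g) (homOpMap S.f)
    (homOpMap_comp_eq_zero S) (fun P _ => homOp_shortExact S hS P) n).app A.unop).unop)

end Ext

/-! ### Local cohomology -/

section LocalCohomology

variable {R : Type u} [CommRing R]

/-- Local cohomology of a module is a colimit of modules. -/
noncomputable def localCohomologyObjIso (J : Ideal R) (i : ℕ) (M : ModuleCat.{u} R) :
    (localCohomology J i).obj M ≅
      colimit ((localCohomology.ringModIdeals (localCohomology.idealPowersDiagram J)).op ⋙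
        (Ext R (ModuleCat.{u} R) i).flip.obj M) :=
  colimitObjIsoColimitCompEvaluation
    (localCohomology.diagram (localCohomology.idealPowersDiagram J) i) M

/-- Dimension shifting for local cohomology along `0 ⟶ X₁ ⟶ X₂ ⟶ X₃ ⟶ 0`, when an element of the
ideal acts bijectively on `X₂`. -/
lemma nonempty_localCohomology_shift (J : Ideal R) (S : ShortComplex (ModuleCat.{u} R))
    (hS : S.ShortExact) (a : R) (ha : a ∈ J)
    (hbij : Function.Bijective fun y : S.X₂ => a • y) (i : ℕ) :
    Nonempty ((localCohomology J (i + 1)).obj S.X₁ ≅ (localCohomology J i).obj S.X₃) := by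
  -- Naturality in `A` makes the connecting maps at `A = R ⧸ J ^ k` a map of direct systems; the
  -- exponent of `a` has to grow with `k` for it to kill `R ⧸ J ^ k`.
  let τ := Functor.whiskerLeft
    (localCohomology.ringModIdeals (localCohomology.idealPowersDiagram J)).op (extδ S hS i)
  have hτ : ∀ k, IsIso (τ.app k) := by
    intro k
    refine isIso_extδ_app S hS i (a ^ k.unop.unop) ?_ _ ?_
    · rw [ConcreteCategory.isIso_iff_bijective]
      have : ∀ n : ℕ, Function.Bijective fun y : S.X₂ => a ^ n • y := by
        intro n
        induction n with
        | zero => simpa using! Function.bijective_id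
        | succ n ih =>
          convert ih.comp hbij using 2
          simp [pow_succ, mul_smul]
      exact this _
    · ext y
      obtain ⟨y, rfl⟩ := Submodule.Quotient.mk_surjective _ y
      refine (Submodule.Quotient.mk_eq_zero _).2 ?_
      exact Ideal.mul_mem_right _ _ (Ideal.pow_mem_pow ha _)
  have : IsIso τ := NatIso.isIso_of_isIso_app _
  exact ⟨localCohomologyObjIso J (i + 1) S.X₁ ≪≫ (HasColimit.isoOfNatIso (asIso τ)).symm ≪≫
    (localCohomologyObjIso J i S.X₃).symm⟩

/-- Right exactness is what identifies the zeroth left derived functor with `homOp M`, that is,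
`Ext⁰` with `Hom`. -/
instance (M : ModuleCat.{u} R) : PreservesFiniteColimits (homOp M) := by
  have : PreservesLimits (((linearYoneda R (ModuleCat.{u} R)).obj M) ⋙ forget (ModuleCat.{u} R)) :=
    inferInstanceAs (PreservesLimits (yoneda.obj M))
  have : PreservesLimits ((linearYoneda R (ModuleCat.{u} R)).obj M) :=
    preservesLimits_of_reflects_of_preserves _ (forget (ModuleCat.{u} R))
  have : PreservesFiniteLimits ((linearYoneda R (ModuleCat.{u} R)).obj M) := inferInstance
  exact preservesFiniteColimits_rightOp _

/-- `H⁰` of a torsion module is the module itself. -/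
lemma nonempty_localCohomology_zero (J : Ideal R) (M : Type u) [AddCommGroup M] [Module R M]
    (hM : ∀ z : M, ∃ n : ℕ, ∀ a ∈ J ^ n, a • z = 0) :
    Nonempty ((localCohomology J 0).obj (ModuleCat.of R M) ≅ ModuleCat.of R M) := by
  let Q := (localCohomology.ringModIdeals (localCohomology.idealPowersDiagram J)).op
  let F := Q ⋙ (linearYoneda R (ModuleCat.{u} R)).obj (ModuleCat.of R M)
  have e : Q ⋙ (Ext R (ModuleCat.{u} R) 0).flip.obj (ModuleCat.of R M) ≅ F :=
    Functor.isoWhiskerLeft Q (NatIso.ofComponents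
      (fun A => ((homOp (ModuleCat.of R M)).leftDerivedZeroIsoSelf.app A.unop).unop.symm)
      (fun f => ((NatTrans.leftOp
        (homOp (ModuleCat.of R M)).leftDerivedZeroIsoSelf.inv).naturality f)))
  -- Evaluation at the class of `1` identifies `Hom(R ⧸ J ^ k, M)` with the elements killed by `J ^
  -- k`; their union is `M` by torsion.
  let ev (k : (ℕᵒᵖ)ᵒᵖ) : F.obj k →ₗ[R] M :=
    { toFun := fun f => (ModuleCat.Hom.hom
          (show ModuleCat.of R (R ⧸ J ^ k.unop.unop) ⟶ ModuleCat.of R M from f) :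
            (R ⧸ J ^ k.unop.unop) →ₗ[R] M) (Submodule.Quotient.mk 1)
      map_add' := fun _ _ => rfl
      map_smul' := fun _ _ => rfl }
  have hev : ∀ k, Function.Injective (ev k) := by
    intro k f g hfg
    refine ModuleCat.hom_ext (Submodule.linearMap_qext _ (LinearMap.ext_ring ?_))
    exact hfg
  let c : Cocone F :=
    { pt := ModuleCat.of R M
      ι := { app := fun k => ModuleCat.ofHom (ev k)
             naturality := fun k l φ => by
              ext f
              rfl } }
  have : PreservesFilteredColimitsOfSize.{0, 0} (forget (ModuleCat.{u} R)) :=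
    preservesFilteredColimitsOfSize_shrink.{0, u, 0, u} _
  have : PreservesColimitsOfShape (ℕᵒᵖ)ᵒᵖ (forget (ModuleCat.{u} R)) :=
    PreservesFilteredColimitsOfSize.preserves_filtered_colimits _
  have hbij : Function.Bijective (colimit.desc F c) := by
    constructor
    · rw [injective_iff_map_eq_zero]
      intro z hz
      obtain ⟨k, f, rfl⟩ := Concrete.colimit_exists_rep F z
      have h1 : ev k f = 0 := by
        rw [← hz]
        exact (ConcreteCategory.congr_hom (colimit.ι_desc c k) f).symm
      rw [(injective_iff_map_eq_zero (ev k)).1 (hev k) f h1, map_zero]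
    · intro z
      obtain ⟨n, hn⟩ := hM z
      let f : F.obj (.op (.op n)) := ModuleCat.ofHom
        ((J ^ n).liftQ (LinearMap.toSpanSingleton R M z) (fun a ha => by simpa using hn a ha))
      refine ⟨colimit.ι F (.op (.op n)) f, ?_⟩
      refine (ConcreteCategory.congr_hom (colimit.ι_desc c (.op (.op n))) f).trans ?_
      exact one_smul R z
  have : IsIso (colimit.desc F c) := (ConcreteCategory.isIso_iff_bijective _).2 hbij
  exact ⟨localCohomologyObjIso J 0 _ ≪≫ HasColimit.isoOfNatIso e ≪≫ asIso (colimit.desc F c)⟩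

end LocalCohomology

/-! ### Towers of elements and local cohomology -/

section Towers

variable {R : Type u} [CommRing R]

/-- Every `x j` maps the elements killed by any finite set of other members of the family `x` onto
themselves. -/
def IsStronglyCoregular {ι : Type*} (x : ι → R) (X : Type u) [AddCommGroup X] [Module R X] :
    Prop :=
  ∀ (S : Finset ι) (j : ι), j ∉ S → ∀ z : X, (∀ i ∈ S, x i • z = 0) →
    ∃ w : X, (∀ i ∈ S, x i • w = 0) ∧ x j • w = z

/-- The limit of `X ← X ← X ← ⋯` along multiplication by `a`. -/
def mulTower (a : R) (X : Type u) [AddCommGroup X] [Module R X] : Submodule R (ℕ → X) where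
  carrier := {m | ∀ n, a • m (n + 1) = m n}
  zero_mem' := fun _ => smul_zero _
  add_mem' := fun h h' n => by simp [smul_add, h n, h' n]
  smul_mem' := fun r m h n => by simp [smul_comm a r, h n]

/-- The limit of the modules `0 :_X aⁿ⁺¹` along multiplication by `a`. -/
def mulTowerKer (a : R) (X : Type u) [AddCommGroup X] [Module R X] : Submodule R (ℕ → X) where
  carrier := {m | a • m 0 = 0 ∧ ∀ n, a • m (n + 1) = m n}
  zero_mem' := ⟨smul_zero _, fun _ => smul_zero _⟩
  add_mem' := fun h h' => ⟨by simp [smul_add, h.1, h'.1], fun n => by simp [smul_add, h.2 n, h'.2 n]⟩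
  smul_mem' := fun r m h => ⟨by simp [smul_comm a r, h.1], fun n => by simp [smul_comm a r, h.2 n]⟩

/-- The limit of the modules `0 :_X (x₁ⁿ⁺¹, …, x_dⁿ⁺¹)` along multiplication by `x₁ ⋯ x_d`. -/
def torsionTower {d : ℕ} (x : Fin d → R) (X : Type u) [AddCommGroup X] [Module R X] :
    Submodule R (ℕ → X) where
  carrier := {m | (∀ n i, x i ^ (n + 1) • m n = 0) ∧ ∀ n, (∏ i, x i) • m (n + 1) = m n}
  zero_mem' := ⟨fun _ _ => smul_zero _, fun _ => smul_zero _⟩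
  add_mem' := fun h h' =>
    ⟨fun n i => by simp [smul_add, h.1 n, h'.1 n], fun n => by simp [smul_add, h.2 n, h'.2 n]⟩
  smul_mem' := fun r m h => ⟨fun n i => by simp [smul_comm _ r, h.1 n],
    fun n => by simp [smul_comm _ r, h.2 n]⟩

variable {X : Type u} [AddCommGroup X] [Module R X]

lemma exists_seq_of_step {α : Type*} (P : ℕ → α → α → Prop) (Q : ℕ → α → Prop)
    (a₀ : α) (h₀ : Q 0 a₀) (h : ∀ n a, Q n a → ∃ b, Q (n + 1) b ∧ P n a b) :
    ∃ s : ℕ → α, s 0 = a₀ ∧ (∀ n, Q n (s n)) ∧ ∀ n, P n (s n) (s (n + 1)) := by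
  choose f hf using h
  let t : ∀ n : ℕ, {a // Q n a} := fun n =>
    Nat.rec ⟨a₀, h₀⟩ (fun n a => ⟨f n a.1 a.2, (hf n a.1 a.2).1⟩) n
  exact ⟨fun n => (t n).1, rfl, fun n => (t n).2, fun n => (hf n (t n).1 (t n).2).2⟩

lemma exists_mulTower_of_surjective (a : R) (ha : ∀ z : X, ∃ w, a • w = z) (z : X) :
    ∃ m ∈ mulTower a X, m 0 = z := by
  obtain ⟨s, h0, -, hs⟩ := exists_seq_of_step (fun _ z w => a • w = z) (fun _ _ => True) z trivial
    (fun _ z _ => (ha z).imp fun _ h => ⟨trivial, h⟩)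
  exact ⟨s, hs, h0⟩

/-- The inverse of multiplication by `a` is the shift of a tower. -/
lemma mulTower_smul_bijective (a : R) : Function.Bijective fun m : mulTower a X => a • m := by
  constructor
  · intro m m' h
    ext n
    have := congrArg (fun t : mulTower a X => t.1 (n + 1)) h
    simpa [m.2 n, m'.2 n] using this
  · intro m
    refine ⟨⟨fun n => m.1 (n + 1), fun n => m.2 (n + 1)⟩, ?_⟩
    ext n
    exact m.2 n

/-- The short exact sequence `0 ⟶ lim (0 :_X aⁿ) ⟶ lim X ⟶ X ⟶ 0`. -/
noncomputable def mulTowerSequence (a : R) (X : Type u) [AddCommGroup X] [Module R X] :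
    ShortComplex (ModuleCat.{u} R) :=
  ShortComplex.mk
    (ModuleCat.ofHom (Submodule.inclusion (fun _ h => h.2) : mulTowerKer a X →ₗ[R] mulTower a X))
    -- The extra factor `a` makes the kernel condition `a • m 0 = 0` instead of `m 0 = 0`, since
    -- entry `0` carries exponent `1`.
    (ModuleCat.ofHom (a • (LinearMap.proj 0).comp (mulTower a X).subtype)) (by
      ext m
      exact m.2.1)

lemma mulTowerSequence_shortExact (a : R) (ha : ∀ z : X, ∃ w, a • w = z) :
    (mulTowerSequence a X).ShortExact := by
  refine ShortComplex.ShortExact.mk' ?_ ?_ ?_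
  · rw [ShortComplex.moduleCat_exact_iff]
    intro (m : mulTower a X) (hm : a • m.1 0 = 0)
    exact ⟨(⟨m.1, hm, m.2⟩ : mulTowerKer a X), rfl⟩
  · rw [ModuleCat.mono_iff_injective]
    exact Submodule.inclusion_injective
      (fun _ h => h.2 : mulTowerKer a X ≤ mulTower a X)
  · rw [ModuleCat.epi_iff_surjective]
    intro (z : X)
    obtain ⟨w, rfl⟩ := ha z
    obtain ⟨m, hm, rfl⟩ := exists_mulTower_of_surjective a ha w
    exact ⟨(⟨m, hm⟩ : mulTower a X), rfl⟩

lemma nonempty_localCohomology_mulTowerKer (J : Ideal R) (a : R) (haJ : a ∈ J)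
    (ha : ∀ z : X, ∃ w, a • w = z) (i : ℕ) :
    Nonempty ((localCohomology J (i + 1)).obj (ModuleCat.of R (mulTowerKer a X)) ≅
      (localCohomology J i).obj (ModuleCat.of R X)) :=
  nonempty_localCohomology_shift J (mulTowerSequence a X) (mulTowerSequence_shortExact a ha) a haJ
    (mulTower_smul_bijective a) i

/-- A preimage of a tower under `x j.succ` is built level by level. A lift `b` of the previous entry
along `x 0` may miss the prescribed value of `x j.succ • b`, but the error is killed by `x 0` and by
the elements of `S`, so it can be removed by a `c` killed by the same elements. This is where
surjectivity on arbitrary partial annihilators is used. -/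
lemma IsStronglyCoregular.mulTowerKer {d : ℕ} {x : Fin (d + 1) → R}
    (hx : IsStronglyCoregular x X) :
    IsStronglyCoregular (fun i : Fin d => x i.succ) (mulTowerKer (x 0) X) := by
  classical
  intro S j hj m hm
  have hm' : ∀ n, ∀ i ∈ S, x i.succ • m.1 n = 0 := fun n i hi =>
    congrArg (fun t : _root_.mulTowerKer (x 0) X => t.1 n) (hm i hi)
  let S' : Finset (Fin (d + 1)) := S.image Fin.succ
  have h0 : (0 : Fin (d + 1)) ∉ S' := by simp [S']
  have hjS : j.succ ∉ insert 0 S' := by simpa [S', Fin.succ_ne_zero] using hj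
  have step : ∀ (n : ℕ) (w : X), (∀ i ∈ S, x i.succ • w = 0) → ∀ z : X,
      (∀ i ∈ S, x i.succ • z = 0) → x 0 • z = x j.succ • w →
      ∃ b : X, (∀ i ∈ S, x i.succ • b = 0) ∧ x j.succ • b = z ∧ x 0 • b = w := by
    intro n w hw z hz hzw
    obtain ⟨b, hb, hbw⟩ := hx S' 0 h0 w (by simpa [S'] using hw)
    have hb' : ∀ i ∈ S, x i.succ • b = 0 := by simpa [S'] using hb
    obtain ⟨c, hc, hcz⟩ := hx (insert 0 S') j.succ hjS (x j.succ • b - z) (by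
      simp only [Finset.mem_insert, forall_eq_or_imp]
      constructor
      · rw [smul_sub, smul_comm, hbw, hzw, sub_self]
      · simp only [S', Finset.mem_image, forall_exists_index, and_imp,
          forall_apply_eq_imp_iff₂]
        intro i hi
        rw [smul_sub, smul_comm, hb' i hi, hz i hi, smul_zero, sub_zero])
    simp only [Finset.mem_insert, forall_eq_or_imp, S', Finset.mem_image, forall_exists_index,
      and_imp, forall_apply_eq_imp_iff₂] at hc
    refine ⟨b - c, fun i hi => ?_, ?_, ?_⟩
    · rw [smul_sub, hb' i hi, hc.2 i hi, sub_zero]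
    · rw [smul_sub, hcz, sub_sub_cancel]
    · rw [smul_sub, hbw, hc.1, sub_zero]
  -- The bottom entry is a lift of a fictitious previous entry `0`.
  obtain ⟨b₀, hb₀, hb₀', hb₀''⟩ := step 0 0 (by simp) (m.1 0) (hm' 0) (by simp [m.2.1])
  obtain ⟨s, hs0, hs, hs'⟩ := exists_seq_of_step (fun _ z w => x 0 • w = z)
    (fun n w => (∀ i ∈ S, x i.succ • w = 0) ∧ x j.succ • w = m.1 n) b₀ ⟨hb₀, hb₀'⟩ (by
      intro n w hw
      obtain ⟨b, hb, hb', hb''⟩ := step 0 w hw.1 (m.1 (n + 1)) (hm' _) (by rw [m.2.2, hw.2])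
      exact ⟨b, ⟨hb, hb'⟩, hb''⟩)
  refine ⟨⟨s, by rw [hs0, hb₀''], hs'⟩, fun i hi => ?_, ?_⟩
  · ext n
    exact (hs n).1 i hi
  · ext n
    exact (hs n).2

/-! ### Towers for several elements and the iterated degree shift. -/

lemma pow_smul_mulTowerKer {a : R} (m : mulTowerKer a X) (n k : ℕ) :
    a ^ k • m.1 (n + k) = m.1 n := by
  induction k with
  | zero => simp
  | succ k ih => rw [pow_succ, mul_smul, ← add_assoc, m.2.2, ih]

lemma pow_succ_smul_mulTowerKer {a : R} (m : mulTowerKer a X) (n : ℕ) :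
    a ^ (n + 1) • m.1 n = 0 := by
  have := pow_smul_mulTowerKer m 0 n
  rw [zero_add] at this
  rw [pow_succ', mul_smul, this, m.2.1]

lemma pow_smul_torsionTower {d : ℕ} {x : Fin d → R} (m : torsionTower x X) (n k : ℕ) :
    (∏ i, x i) ^ k • m.1 (n + k) = m.1 n := by
  induction k with
  | zero => simp
  | succ k ih => rw [pow_succ, mul_smul, ← add_assoc, m.2.2, ih]

/-- A tower for `d + 1` elements is a tower for the last `d` of them of towers for the first. -/
noncomputable def torsionTowerEquiv {d : ℕ} (x : Fin (d + 1) → R) (X : Type u) [AddCommGroup X]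
    [Module R X] :
    torsionTower (fun i : Fin d => x i.succ) (mulTowerKer (x 0) X) ≃ₗ[R] torsionTower x X where
  -- The diagonal of the double tower.
  toFun m := ⟨fun n => (m.1 n).1 n, by
    refine ⟨fun n i => ?_, fun n => ?_⟩
    · refine Fin.cases ?_ (fun i => ?_) i
      · exact pow_succ_smul_mulTowerKer (m.1 n) n
      · exact congrArg (fun t : mulTowerKer (x 0) X => t.1 n) (m.2.1 n i)
    · rw [Fin.prod_univ_succ, mul_comm, mul_smul, (m.1 (n + 1)).2.2 n]
      exact congrArg (fun t : mulTowerKer (x 0) X => t.1 n) (m.2.2 n)⟩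
  map_add' _ _ := rfl
  map_smul' _ _ := rfl
  -- Entry `(k, n)` is reached from the diagonal entry `(N, N)` by `N - n` steps of `x 0` and `N -
  -- k` steps of the remaining product; here `N = n + k + 1`.
  invFun m := ⟨fun k => ⟨fun n => (x 0 ^ (k + 1) * (∏ i : Fin d, x i.succ) ^ (n + 1)) •
      m.1 (n + k + 1), by
    have h := fun n => m.2.2 n
    rw [Fin.prod_univ_succ] at h
    refine ⟨?_, fun n => ?_⟩
    · rw [← mul_smul, ← mul_assoc, ← pow_succ', zero_add, zero_add,
        mul_comm (x 0 ^ (k + 1 + 1)), mul_smul, m.2.1, smul_zero]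
    · dsimp only
      rw [← h (n + k + 1), ← mul_smul, ← mul_smul, show n + 1 + k + 1 = n + k + 1 + 1 by ring]
      congr 1
      ring⟩, by
    have h := fun n => m.2.2 n
    rw [Fin.prod_univ_succ] at h
    refine ⟨fun k i => ?_, fun k => ?_⟩
    · ext n
      change x i.succ ^ (k + 1) • (x 0 ^ (k + 1) * (∏ i : Fin d, x i.succ) ^ (n + 1)) •
        m.1 (n + k + 1) = 0
      obtain ⟨c, hc⟩ : x i.succ ^ (n + 1) ∣ (∏ i : Fin d, x i.succ) ^ (n + 1) :=
        pow_dvd_pow_of_dvd (Finset.dvd_prod_of_mem _ (Finset.mem_univ i)) _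
      rw [hc, ← mul_smul, show x i.succ ^ (k + 1) * (x 0 ^ (k + 1) * (x i.succ ^ (n + 1) * c)) =
        (x 0 ^ (k + 1) * c) * x i.succ ^ (n + k + 1 + 1) by ring, mul_smul, m.2.1, smul_zero]
    · ext n
      change (∏ i : Fin d, x i.succ) • (x 0 ^ (k + 1 + 1) * (∏ i : Fin d, x i.succ) ^ (n + 1)) •
        m.1 (n + (k + 1) + 1) = (x 0 ^ (k + 1) * (∏ i : Fin d, x i.succ) ^ (n + 1)) •
        m.1 (n + k + 1)
      rw [← h (n + k + 1), ← mul_smul, ← mul_smul]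
      congr 1
      ring⟩
  left_inv m := by
    ext k n
    change (x 0 ^ (k + 1) * (∏ i : Fin d, x i.succ) ^ (n + 1)) • (m.1 (n + k + 1)).1 (n + k + 1) = _
    rw [mul_comm, mul_smul, show (n + k + 1) = n + (k + 1) by ring, pow_smul_mulTowerKer]
    have := congrArg (fun t : mulTowerKer (x 0) X => t.1 n) (pow_smul_torsionTower m k (n + 1))
    rw [show n + (k + 1) = k + (n + 1) by ring]
    exact this
  right_inv m := by
    ext n
    change (x 0 ^ (n + 1) * (∏ i : Fin d, x i.succ) ^ (n + 1)) • m.1 (n + n + 1) = _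
    rw [← mul_pow, ← Fin.prod_univ_succ]
    exact pow_smul_torsionTower m n (n + 1)

/-- Induction on `d` with `X` and `i` free: the inductive hypothesis is applied to `mulTowerKer (x
0) X` in degree `i + 1`, and one more shift leads back to `X` in degree `i`. -/
lemma nonempty_localCohomology_torsionTower (J : Ideal R) (d : ℕ) :
    ∀ (X : Type u) [AddCommGroup X] [Module R X] (x : Fin d → R), (∀ i, x i ∈ J) →
      IsStronglyCoregular x X → ∀ i : ℕ,
      Nonempty ((localCohomology J (i + d)).obj (ModuleCat.of R (torsionTower x X)) ≅
        (localCohomology J i).obj (ModuleCat.of R X)) := by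
  induction d with
  | zero =>
    intro X _ _ x _ _ i
    have hc : ∀ (m : torsionTower x X) n, m.1 n = m.1 0 := by
      intro m n
      have := pow_smul_torsionTower m 0 n
      simpa using this
    let e : torsionTower x X ≃ₗ[R] X :=
      { toFun := fun m => m.1 0
        map_add' := fun _ _ => rfl
        map_smul' := fun _ _ => rfl
        invFun := fun z => ⟨fun _ => z, fun _ i => i.elim0, fun _ => by simp⟩
        left_inv := fun m => by
          ext n
          exact (hc m n).symm
        right_inv := fun _ => rfl }
    exact ⟨(localCohomology J i).mapIso e.toModuleIso⟩
  | succ d ih =>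
    intro X _ _ x hxJ hx i
    obtain ⟨e₁⟩ := ih (mulTowerKer (x 0) X) (fun i => x i.succ) (fun i => hxJ _) hx.mulTowerKer
      (i + 1)
    obtain ⟨e₂⟩ := nonempty_localCohomology_mulTowerKer (X := X) J (x 0) (hxJ 0)
      (fun z => (hx ∅ 0 (by simp) z (by simp)).imp fun _ h => h.2) i
    rw [show i + (d + 1) = i + 1 + d by ring]
    exact ⟨(localCohomology J (i + 1 + d)).mapIso (torsionTowerEquiv x X).toModuleIso.symm ≪≫
      e₁ ≪≫ e₂⟩

end Towers

/-! ### Top local homology -/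

section TopHomology

namespace KoszulComplex

variable {R : Type u} [CommRing R] {d : ℕ} (X : Type u) [AddCommGroup X] [Module R X]

/-- The full index set, the only one in top degree. -/
def Idx.top (d : ℕ) : Idx d d := ⟨Finset.univ, by simp⟩

instance (d : ℕ) : Subsingleton (Idx d d) :=
  ⟨fun s t => Subtype.ext (by
    rw [(Finset.card_eq_iff_eq_univ s.1).1 (by simp [s.2]),
      (Finset.card_eq_iff_eq_univ t.1).1 (by simp [t.2])])⟩

lemma dLin_top_erase {p : ℕ} (y : Fin (p + 1) → R) (f : Idx (p + 1) (p + 1) → X)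
    (i : Fin (p + 1)) (s : Idx (p + 1) p) (hs : s.1 = Finset.univ.erase i) :
    dLin y X p f s = (sgn s.1 i * y i) • f (Idx.top _) := by
  change ∑ j : {j // j ∉ s.1}, (sgn s.1 j.1 * y j.1) • f (s.insert j) = _
  have : Unique {j // j ∉ s.1} :=
    { default := ⟨i, by simp [hs]⟩
      uniq := fun j => Subtype.ext (by simpa [hs] using j.2) }
  rw [Fintype.sum_unique, Subsingleton.elim (s.insert default) (Idx.top _)]
  have h2 : (default : {j // j ∉ s.1}).1 = i := by
    simpa [hs] using (default : {j // j ∉ s.1}).2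
  rw [h2]

lemma dLin_top_eq_zero_iff {p : ℕ} (y : Fin (p + 1) → R) (f : Idx (p + 1) (p + 1) → X) :
    dLin y X p f = 0 ↔ ∀ i, y i • f (Idx.top _) = 0 := by
  constructor
  · intro h i
    have h1 := dLin_top_erase X y f i ⟨Finset.univ.erase i, by simp⟩ rfl
    rw [h, mul_smul, sgn] at h1
    rcases neg_one_pow_eq_or R ((Finset.univ.erase i).filter (· < i)).card with h3 | h3
    · simpa [h3] using h1.symm
    · simpa [h3] using h1.symm
  · intro h
    funext s
    change ∑ j : {j // j ∉ s.1}, (sgn s.1 j.1 * y j.1) • f (s.insert j) = 0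
    refine Finset.sum_eq_zero fun j _ => ?_
    rw [Subsingleton.elim (s.insert j) (Idx.top _), mul_smul, h, smul_zero]

lemma koszul_d_top_eq_zero_iff (y : Fin d → R) (f : Idx d d → X) :
    (koszul y X).d d ((ComplexShape.down ℕ).next d) f = 0 ↔ ∀ i, y i • f (Idx.top _) = 0 := by
  cases d with
  | zero =>
    -- In degree `0` the outgoing differential is zero and there are no conditions on the right.
    refine ⟨fun _ i => i.elim0, fun _ => ?_⟩
    rw [(koszul y X).shape]
    · rfl
    · simp
  | succ p =>
    rw [← dLin_top_eq_zero_iff]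
    rw [show (ComplexShape.down ℕ).next (p + 1) = p from ChainComplex.next_nat_succ p]
    have : (koszul y X).d (p + 1) p = ModuleCat.ofHom (dLin y X p) :=
      ChainComplex.of_d (fun p => ModuleCat.of R (Idx _ p → X))
        (fun p => ModuleCat.ofHom (dLin y X p)) p
    rw [this]
    rfl

lemma isZero_koszul_X_succ (y : Fin d → R) : IsZero ((koszul y X).X (d + 1)) := by
  have : IsEmpty (Idx d (d + 1)) :=
    ⟨fun s => by
      have := Finset.card_le_univ s.1
      rw [s.2, Fintype.card_fin] at this
      omega⟩
  exact ModuleCat.isZero_of_iff_subsingleton.2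
    (inferInstanceAs (Subsingleton (Idx d (d + 1) → X)))

/-- There are no chains in degree `d + 1`, hence no boundaries to divide by. -/
lemma isIso_homologyπ_top (y : Fin d → R) : IsIso ((koszul y X).homologyπ d) :=
  (koszul y X).isIso_homologyπ (d + 1) d (by simp)
    ((isZero_koszul_X_succ X y).eq_of_src _ _)

/-- The coordinate of a chain in top degree. -/
def topCoord (d : ℕ) : (Idx d d → X) ≃ₗ[R] X where
  toFun f := f (Idx.top d)
  map_add' _ _ := rfl
  map_smul' _ _ := rfl
  invFun z _ := z
  left_inv f := by
    funext s
    rw [Subsingleton.elim s (Idx.top d)]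
  right_inv _ := rfl

/-- The coordinate of a chain in top degree, as a morphism. -/
noncomputable def topCoordHom (y : Fin d → R) : (koszul y X).X d ⟶ ModuleCat.of R X :=
  ModuleCat.ofHom (topCoord X d).toLinearMap

/-- The embedding of the top Koszul homology into the module. -/
noncomputable def topHomologyHom (y : Fin d → R) : (koszul y X).homology d ⟶ ModuleCat.of R X :=
  have := isIso_homologyπ_top X y
  inv ((koszul y X).homologyπ d) ≫ (koszul y X).iCycles d ≫ topCoordHom X y

lemma topHomologyHom_injective (y : Fin d → R) : Function.Injective (topHomologyHom X y) := by
  have := isIso_homologyπ_top X y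
  rw [topHomologyHom]
  have : Mono (topCoordHom X y) :=
    (ModuleCat.mono_iff_injective _).2 (topCoord (R := R) X d).injective
  have h2 : Mono ((koszul y X).iCycles d ≫ topCoordHom X y) :=
    mono_comp _ _
  rw [← ModuleCat.mono_iff_injective]
  exact mono_comp _ _

lemma range_topHomologyHom (y : Fin d → R) (z : X) :
    z ∈ LinearMap.range (topHomologyHom X y).hom ↔ ∀ i, y i • z = 0 := by
  have := isIso_homologyπ_top X y
  have hex : (ShortComplex.mk _ _ ((koszul y X).iCycles_d d _)).Exact :=
    ShortComplex.exact_of_f_is_kernel _ ((koszul y X).cyclesIsKernel d _ rfl)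
  rw [ShortComplex.moduleCat_exact_iff] at hex
  constructor
  · rintro ⟨h, rfl⟩
    let c : (koszul y X).cycles d := inv ((koszul y X).homologyπ d) h
    refine (koszul_d_top_eq_zero_iff X y ((koszul y X).iCycles d c)).1 ?_
    exact ConcreteCategory.congr_hom ((koszul y X).iCycles_d d _) c
  · intro hz
    obtain ⟨c, hc⟩ := hex (fun _ => z : Idx d d → X) ((koszul_d_top_eq_zero_iff X y _).2 hz)
    refine ⟨(koszul y X).homologyπ d c, ?_⟩
    have h1 : inv ((koszul y X).homologyπ d) ((koszul y X).homologyπ d c) = c :=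
      ConcreteCategory.congr_hom (IsIso.hom_inv_id ((koszul y X).homologyπ d)) c
    change topCoord (R := R) X d ((koszul y X).iCycles d
      (inv ((koszul y X).homologyπ d) ((koszul y X).homologyπ d c))) = z
    rw [h1]
    exact congrArg (topCoord (R := R) X d) hc

/-- The only basis element in top degree is indexed by the full set, on which the transition map is
the product of all `x i`. -/
lemma topHomologyHom_trans (x : Fin d → R) (n : ℕ)
    (h : (koszul (fun i => x i ^ (n + 1)) X).homology d) :
    topHomologyHom X _ (HomologicalComplex.homologyMap (trans x X n) d h) =
      (∏ i, x i) • (topHomologyHom X _ h : X) := by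
  have i1 := isIso_homologyπ_top X (fun i => x i ^ (n + 1))
  have i2 := isIso_homologyπ_top X (fun i => x i ^ n)
  have h1 : HomologicalComplex.homologyMap (trans x X n) d ≫ topHomologyHom X _ =
      inv ((koszul (fun i => x i ^ (n + 1)) X).homologyπ d) ≫
        (koszul (fun i => x i ^ (n + 1)) X).iCycles d ≫ (trans x X n).f d ≫
          topCoordHom X _ := by
    rw [IsIso.eq_inv_comp, HomologicalComplex.homologyπ_naturality_assoc, topHomologyHom,
      IsIso.hom_inv_id_assoc, HomologicalComplex.cyclesMap_i_assoc]
  exact ConcreteCategory.congr_hom h1 h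

end KoszulComplex

open KoszulComplex

variable {R : Type u} [CommRing R] {d : ℕ} (X : Type u) [AddCommGroup X] [Module R X]

/-- The embedding of the terms of the inverse system defining top local homology. -/
noncomputable def systemHom (x : Fin d → R) (n : ℕ) :
    (koszulHomologySystem x X d).obj (.op n) ⟶ ModuleCat.of R X :=
  topHomologyHom X (fun i => x i ^ (n + 1))

lemma systemHom_map (x : Fin d → R) (n : ℕ) (h : (koszulHomologySystem x X d).obj (.op (n + 1))) :
    systemHom X x n ((koszulHomologySystem x X d).map (homOfLE (n.le_add_right 1)).op h) =
      (∏ i, x i) • (systemHom X x (n + 1) h : X) := by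
  have : (koszulHomologySystem x X d).map (homOfLE (n.le_add_right 1)).op =
      HomologicalComplex.homologyMap (KoszulComplex.trans x X (n + 1)) d :=
    Functor.ofOpSequence_map_homOfLE_succ _ n
  rw [this]
  exact topHomologyHom_trans X x (n + 1) h

/-- Towers as elements of the terms of the inverse system. -/
noncomputable def towerToSystem (x : Fin d → R) (n : ℕ) :
    torsionTower x X →ₗ[R] (koszulHomologySystem x X d).obj (.op n) :=
  (LinearEquiv.ofInjective (systemHom X x n).hom (topHomologyHom_injective X _)).symm.toLinearMap.comp
    (LinearMap.codRestrict _ ((LinearMap.proj n).comp (torsionTower x X).subtype)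
      (fun m => (range_topHomologyHom X _ _).2 (m.2.1 n)))

lemma systemHom_towerToSystem (x : Fin d → R) (n : ℕ) (m : torsionTower x X) :
    systemHom X x n (towerToSystem X x n m) = m.1 n := by
  have := LinearEquiv.apply_symm_apply
    (LinearEquiv.ofInjective (systemHom X x n).hom (topHomologyHom_injective X _))
    (LinearMap.codRestrict _ ((LinearMap.proj n).comp (torsionTower x X).subtype)
      (fun m => (range_topHomologyHom X _ _).2 (m.2.1 n)) m)
  exact congrArg Subtype.val this

/-- All terms of the system embed in `X` through `systemHom`, so the limit can be computed with
sequences in `X`. -/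
lemma nonempty_localHomology_iso_torsionTower (x : Fin d → R) :
    Nonempty (localHomology x X d ≅ ModuleCat.of R (torsionTower x X)) := by
  let c : Cone (koszulHomologySystem x X d) :=
    { pt := ModuleCat.of R (torsionTower x X)
      π := NatTrans.ofOpSequence (fun n => ModuleCat.ofHom (towerToSystem X x n)) (by
        intro n
        ext m
        apply topHomologyHom_injective
        change systemHom X x n (towerToSystem X x n m) = systemHom X x n
          ((koszulHomologySystem x X d).map (homOfLE (n.le_add_right 1)).op
            (towerToSystem X x (n + 1) m))
        rw [systemHom_map, systemHom_towerToSystem, systemHom_towerToSystem, m.2.2 n]) }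
  have hc : ∀ (m : torsionTower x X) n, systemHom X x n
      (limit.π (koszulHomologySystem x X d) (.op n) (limit.lift _ c m)) = m.1 n := by
    intro m n
    rw [← systemHom_towerToSystem X x n m]
    congr 1
    exact ConcreteCategory.congr_hom (limit.lift_π c (.op n)) m
  have hbij : Function.Bijective (limit.lift (koszulHomologySystem x X d) c) := by
    constructor
    · intro m m' h
      ext n
      rw [← hc m n, ← hc m' n, h]
    · intro z
      let m : torsionTower x X :=
        ⟨fun n => systemHom X x n (limit.π (koszulHomologySystem x X d) (.op n) z),
          fun n => (range_topHomologyHom X _ _).1 ⟨_, rfl⟩, fun n => by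
            rw [← systemHom_map]
            congr 1
            exact ConcreteCategory.congr_hom (limit.w (koszulHomologySystem x X d)
              (homOfLE (n.le_add_right 1)).op) z⟩
      refine ⟨m, Concrete.limit_ext _ _ _ fun n => ?_⟩
      apply topHomologyHom_injective X
      exact hc m n.unop
  have : IsIso (limit.lift (koszulHomologySystem x X d) c) :=
    (ConcreteCategory.isIso_iff_bijective _).2 hbij
  exact ⟨(asIso (limit.lift (koszulHomologySystem x X d) c)).symm⟩

end TopHomology

/-! ### Nilpotence and Fitting-type lemmas for Artinian modules -/

section Artinian

variable {R : Type u} [CommRing R] {X : Type u} [AddCommGroup X] [Module R X]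

/-- A power of the maximal ideal of a local ring kills a module of finite length. -/
lemma exists_maximalIdeal_pow_smul_eq_zero [IsLocalRing R] [IsNoetherian R X] [IsArtinian R X] :
    ∃ n : ℕ, ∀ a ∈ IsLocalRing.maximalIdeal R ^ n, ∀ z : X, a • z = 0 := by
  set m := IsLocalRing.maximalIdeal R
  let F : ℕ →o (Submodule R X)ᵒᵈ :=
    { toFun := fun n => OrderDual.toDual (m ^ n • (⊤ : Submodule R X))
      monotone' := fun a b h => Submodule.smul_mono_left (Ideal.pow_le_pow_right h) }
  obtain ⟨n, hn⟩ := IsArtinian.monotone_stabilizes F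
  have h1 : m ^ n • (⊤ : Submodule R X) = m ^ (n + 1) • (⊤ : Submodule R X) :=
    hn (n + 1) (Nat.le_succ n)
  -- Nakayama's lemma for the stable value of the chain `m ^ n • ⊤`.
  have h2 : m ^ n • (⊤ : Submodule R X) = ⊥ := by
    refine Submodule.eq_bot_of_le_smul_of_le_jacobson_bot m _ (IsNoetherian.noetherian _) ?_
      (IsLocalRing.jacobson_eq_maximalIdeal ⊥ bot_ne_top).ge
    rw [← mul_smul, ← pow_succ']
    exact h1.le
  refine ⟨n, fun a ha z => ?_⟩
  have := Submodule.smul_mem_smul ha (Submodule.mem_top (x := z))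
  rwa [h2] at this

/-- Artinian modules over a Noetherian local ring are torsion. -/
lemma exists_maximalIdeal_pow_smul_eq_zero_of_isArtinian [IsLocalRing R] [IsNoetherianRing R]
    [IsArtinian R X] (z : X) :
    ∃ n : ℕ, ∀ a ∈ IsLocalRing.maximalIdeal R ^ n, a • z = 0 := by
  obtain ⟨n, hn⟩ := exists_maximalIdeal_pow_smul_eq_zero (R := R) (X := Submodule.span R {z})
  exact ⟨n, fun a ha => congrArg Subtype.val
    (hn a ha ⟨z, Submodule.mem_span_singleton_self z⟩)⟩

/-- An element that is nilpotent on `0 :_X x` is nilpotent on every `0 :_X (xᵢⁿ)`. -/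
lemma exists_pow_smul_eq_zero_of_torsion {ι : Type*} [Finite ι] (x : ι → R) (y : R) (N : ℕ)
    (hy : ∀ z : X, (∀ i, x i • z = 0) → y ^ N • z = 0) (n : ℕ) :
    ∃ M : ℕ, ∀ z : X, (∀ i, x i ^ n • z = 0) → y ^ M • z = 0 := by
  -- Each multiplication by `y ^ N` lowers by one the power of the ideal `(x)` needed to kill `z`;
  -- some power of `(x)` lies in the ideal of the `x i ^ n`.
  have key : ∀ k : ℕ, ∀ z : X, (∀ a ∈ Ideal.span (Set.range x) ^ k, a • z = 0) →
      y ^ (N * k) • z = 0 := by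
    intro k
    induction k with
    | zero => intro z hz; simpa using hz 1 (by simp)
    | succ k ih =>
      intro z hz
      rw [mul_add, mul_one, pow_add, mul_smul]
      refine ih _ fun a ha => ?_
      rw [smul_comm]
      refine hy _ fun i => ?_
      rw [← mul_smul]
      refine hz _ ?_
      rw [pow_succ']
      exact Ideal.mul_mem_mul (Ideal.subset_span ⟨i, rfl⟩) ha
  obtain ⟨k, hk⟩ := Ideal.exists_pow_le_of_le_radical_of_fg
    (I := Ideal.span (Set.range x)) (J := Ideal.span (Set.range fun i => x i ^ n))
    (Ideal.span_le.2 (by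
      rintro _ ⟨i, rfl⟩
      exact ⟨n, Ideal.subset_span ⟨i, rfl⟩⟩))
    (Submodule.fg_span (Set.finite_range x))
  refine ⟨N * k, fun z hz => key k z fun a ha => ?_⟩
  have h1 : Ideal.span (Set.range fun i => x i ^ n) ≤ Ideal.torsionOf R X z :=
    Ideal.span_le.2 (by
      rintro _ ⟨i, rfl⟩
      exact hz i)
  exact h1 (hk ha)

/-- Fitting's lemma for multiplication by an element on an Artinian module. -/
lemma exists_pow_smul_sub_eq_zero [IsArtinian R X] (a : R) :
    ∃ n : ℕ, ∀ z : X, ∃ w : X, a ^ n • (z - a • w) = 0 := by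
  let f : Module.End R X := algebraMap R (Module.End R X) a
  have hf : ∀ n z, (f ^ n) z = a ^ n • z := fun n z => by
    rw [← map_pow, Module.algebraMap_end_apply]
  obtain ⟨n, hn⟩ := IsArtinian.monotone_stabilizes f.iterateRange
  have h1 : LinearMap.range (f ^ n) = LinearMap.range (f ^ (n + 1)) := hn (n + 1) (Nat.le_succ n)
  refine ⟨n, fun z => ?_⟩
  obtain ⟨w, hw⟩ : (f ^ n) z ∈ LinearMap.range (f ^ (n + 1)) := h1 ▸ ⟨z, rfl⟩
  rw [hf, hf] at hw
  exact ⟨w, by rw [smul_sub, ← hw, pow_succ, mul_smul, sub_self]⟩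

/-- If each `x i` maps the Artinian submodule `Z` into `B`, then `Z` is contained in `B` up to
elements killed by powers of the `x i`. -/
lemma exists_sub_mem_of_smul_mem {ι : Type*} [Finite ι] (x : ι → R) (Z B : Submodule R X)
    [IsArtinian R X] (hZB : ∀ i, ∀ z ∈ Z, x i • z ∈ B) :
    ∃ n : ℕ, ∀ z ∈ Z, ∃ g ∈ Z, z - g ∈ B ∧ ∀ i, x i ^ n • g = 0 := by
  classical
  have := Fintype.ofFinite ι
  suffices h : ∀ S : Finset ι, ∃ n : ℕ, ∀ z ∈ Z, ∃ g ∈ Z, z - g ∈ B ∧ ∀ i ∈ S, x i ^ n • g = 0 by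
    simpa using h Finset.univ
  intro S
  induction S using Finset.induction_on with
  | empty => exact ⟨0, fun z hz => ⟨z, hz, by simp, by simp⟩⟩
  | insert j S hj ih =>
    obtain ⟨n, hn⟩ := ih
    let W : Submodule R X :=
      { carrier := {g | g ∈ Z ∧ ∀ i ∈ S, x i ^ n • g = 0}
        zero_mem' := ⟨Z.zero_mem, fun i _ => smul_zero _⟩
        add_mem' := fun h h' => ⟨Z.add_mem h.1 h'.1, fun i hi => by
          rw [smul_add, h.2 i hi, h'.2 i hi, add_zero]⟩
        smul_mem' := fun r g h => ⟨Z.smul_mem r h.1, fun i hi => by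
          rw [smul_comm, h.2 i hi, smul_zero]⟩ }
    -- Fitting's lemma inside `W` replaces `g` by `g - x j • w`, which a power of `x j` kills; the
    -- correction `x j • w` lies in `B`.
    obtain ⟨k, hk⟩ := exists_pow_smul_sub_eq_zero (R := R) (X := W) (x j)
    refine ⟨n + k, fun z hz => ?_⟩
    obtain ⟨g, hgZ, hgB, hg⟩ := hn z hz
    obtain ⟨w, hw⟩ := hk ⟨g, hgZ, hg⟩
    have hw' : x j ^ k • (g - x j • w.1) = 0 := congrArg Subtype.val hw
    have hgw : g - x j • w.1 ∈ W := W.sub_mem ⟨hgZ, hg⟩ (W.smul_mem _ w.2)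
    refine ⟨g - x j • w.1, hgw.1, ?_, ?_⟩
    · rw [show z - (g - x j • w.1) = (z - g) + x j • w.1 by abel]
      exact B.add_mem hgB (hZB j _ w.2.1)
    · intro i hi
      rcases Finset.mem_insert.1 hi with rfl | hi
      · rw [pow_add, mul_smul, hw', smul_zero]
      · rw [add_comm n k, pow_add, mul_smul, hgw.2 i hi, smul_zero]

end Artinian

/-! ### Depth sensitivity of the Koszul complex -/

namespace KoszulComplex

variable {R : Type u} [CommRing R] {r : ℕ}

/-! ### Exterior multiplication as a homotopy. -/

section Homotopy

variable {X : Type u} [AddCommGroup X] [Module R X]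

/-- A chain as a function on all finite sets, extended by zero. -/
def extend {p : ℕ} (f : Idx r p → X) (s : Finset (Fin r)) : X :=
  if h : s.card = p then f ⟨s, h⟩ else 0

lemma extend_coe {p : ℕ} (f : Idx r p → X) (s : Idx r p) : extend f s.1 = f s :=
  dif_pos s.2

lemma dLin_apply (x : Fin r → R) {p : ℕ} (f : Idx r (p + 1) → X) (s : Idx r p) :
    dLin x X p f s = ∑ i ∈ s.1ᶜ, (sgn s.1 i * x i) • extend f (insert i s.1) := by
  rw [Finset.sum_subtype (s.1ᶜ) (p := fun i => i ∉ s.1) (by simp)]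
  change ∑ i : {i : Fin r // i ∉ s.1}, (sgn s.1 i.1 * x i.1) • f (s.insert i) = _
  exact Finset.sum_congr rfl fun i _ => by rw [← extend_coe f (s.insert i)]; rfl

lemma sgn_mul_self (s : Finset (Fin r)) (i : Fin r) : (sgn s i * sgn s i : R) = 1 := by
  rw [sgn, ← pow_add]
  exact Even.neg_one_pow ⟨_, rfl⟩

/-- Exterior multiplication by a basis vector. -/
def wedge (j : Fin r) {p : ℕ} (f : Idx r p → X) : Idx r (p + 1) → X :=
  fun s => if j ∈ s.1 then (sgn (s.1.erase j) j : R) • extend f (s.1.erase j) else 0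

lemma extend_wedge (j : Fin r) {p : ℕ} (f : Idx r p → X) (s : Finset (Fin r)) (hj : j ∈ s) :
    extend (wedge (R := R) j f) s = (sgn (s.erase j) j : R) • extend f (s.erase j) := by
  by_cases h : s.card = p + 1
  · rw [extend, dif_pos h, wedge, if_pos hj]
  · rw [extend, dif_neg h, extend, dif_neg, smul_zero]
    rw [Finset.card_erase_of_mem hj]
    have := Finset.card_pos.2 ⟨j, hj⟩
    omega

lemma extend_wedge_of_notMem (j : Fin r) {p : ℕ} (f : Idx r p → X) (s : Finset (Fin r))
    (hj : j ∉ s) : extend (wedge (R := R) j f) s = 0 := by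
  by_cases h : s.card = p + 1
  · rw [extend, dif_pos h, wedge, if_neg hj]
  · rw [extend, dif_neg h]

lemma dLin_wedge_of_notMem (x : Fin r → R) (j : Fin r) {p : ℕ} (f : Idx r p → X) (s : Idx r p)
    (hj : j ∉ s.1) : dLin x X p (wedge (R := R) j f) s = x j • f s := by
  rw [dLin_apply, Finset.sum_eq_single_of_mem j (by simpa using hj)]
  · rw [extend_wedge _ _ _ (Finset.mem_insert_self _ _), Finset.erase_insert hj, extend_coe,
      ← mul_smul, mul_right_comm, sgn_mul_self, one_mul]
  · intro i _ hij
    rw [extend_wedge_of_notMem, smul_zero]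
    simp [hj, hij.symm]

/-- The cycles of the Koszul complex in degree `p`. -/
def cyc (x : Fin r → R) (X : Type u) [AddCommGroup X] [Module R X] :
    ∀ p, Submodule R (Idx r p → X)
  | 0 => ⊤
  | p + 1 => LinearMap.ker (dLin x X p)

lemma dLin_mem_cyc (x : Fin r → R) {p : ℕ} (f : Idx r (p + 1) → X) : dLin x X p f ∈ cyc x X p := by
  cases p with
  | zero => trivial
  | succ p => exact LinearMap.congr_fun (dLin_comp x X p) f

/-- From `d(e_j ∧ f) = x_j f - e_j ∧ df`: every `x j` annihilates Koszul homology. For `j ∈ s` the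
cycle condition at `s \ {j}` isolates the term `x j • f s`. -/
lemma dLin_wedge (x : Fin r → R) (j : Fin r) {p : ℕ} (f : Idx r p → X) (hf : f ∈ cyc x X p) :
    dLin x X p (wedge (R := R) j f) = x j • f := by
  funext s
  by_cases hj : j ∈ s.1
  swap
  · exact dLin_wedge_of_notMem x j f s hj
  cases p with
  | zero => exact absurd s.2 (Finset.card_ne_zero_of_mem hj)
  | succ p =>
    let t : Idx r p := ⟨s.1.erase j, by rw [Finset.card_erase_of_mem hj, s.2]; rfl⟩
    have hjt : j ∉ t.1 := Finset.notMem_erase _ _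
    have hst : s.1 = insert j t.1 := (Finset.insert_erase hj).symm
    have h1 : dLin x X p f t = 0 := congrFun (LinearMap.mem_ker.1 hf) t
    have htc : t.1ᶜ = insert j s.1ᶜ := by
      ext i
      by_cases h : i = j <;> simp [t, h]
    rw [dLin_apply, htc, Finset.sum_insert (by simpa using hj), ← hst, extend_coe] at h1
    have h2 := congrArg (fun z => (sgn t.1 j : R) • z) h1
    simp only [smul_add, smul_zero, ← mul_smul, ← mul_assoc, sgn_mul_self, one_mul,
      Finset.smul_sum] at h2
    rw [dLin_apply, Pi.smul_apply, ← sub_eq_zero, ← neg_eq_zero, neg_sub, sub_eq_add_neg, ← h2]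
    congr 1
    rw [← Finset.sum_neg_distrib]
    refine Finset.sum_congr rfl fun i hi => ?_
    have his : i ∉ s.1 := by simpa using hi
    have hit : i ∉ t.1 := fun h => his (Finset.mem_of_mem_erase h)
    have hij : i ≠ j := fun h => his (h ▸ hj)
    rw [extend_wedge _ _ _ (Finset.mem_insert_of_mem hj), Finset.erase_insert_of_ne hij,
      ← mul_smul, ← neg_smul]
    congr 1
    change -(sgn s.1 i * x i * sgn (insert i t.1) j) = _
    rw [hst]
    rcases lt_or_gt_of_ne hij with h | h
    · rw [sgn_insert_of_lt t.1 hit h, sgn_insert_of_gt t.1 h]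
      ring
    · rw [sgn_insert_of_gt t.1 h, sgn_insert_of_lt t.1 hjt h]
      ring

end Homotopy

/-! ### From coregular sequences to exactness of the Koszul complex. -/

lemma isCoregularSeq_iff (X : Type u) [AddCommGroup X] [Module R X] {n : ℕ} (y : Fin n → R) :
    IsCoregularSeq X y ↔ ∀ i, ∀ z : X, (∀ j < i, y j • z = 0) →
      ∃ w : X, (∀ j < i, y j • w = 0) ∧ y i • w = z := by
  have h : ∀ i (z : X), z ∈ Submodule.torsionBySet R X (y '' Set.Iio i) ↔
      ∀ j < i, y j • z = 0 := by
    intro i z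
    simp [Submodule.mem_torsionBySet_iff]
  refine forall_congr' fun i => forall_congr' fun z => ?_
  rw [SetLike.mem_coe, h]
  refine imp_congr_right fun _ => exists_congr fun w => ?_
  rw [SetLike.mem_coe, h]

lemma _root_.IsCoregularSeq.tail {X : Type u} [AddCommGroup X] [Module R X] {n : ℕ}
    {y : Fin (n + 1) → R} (hy : IsCoregularSeq X y) :
    IsCoregularSeq (Submodule.torsionBy R X (y 0)) (fun i : Fin n => y i.succ) := by
  rw [isCoregularSeq_iff] at hy ⊢
  intro i z hz
  obtain ⟨w, hw, hwz⟩ := hy i.succ z.1 (by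
    intro j
    refine Fin.cases (fun _ => z.2) (fun j hj => ?_) j
    exact congrArg Subtype.val (hz j (Fin.succ_lt_succ_iff.1 hj)))
  exact ⟨⟨w, hw 0 (Fin.succ_pos _)⟩, fun j hj => Subtype.ext (hw j.succ (Fin.succ_lt_succ_iff.2 hj)),
    Subtype.ext hwz⟩

/-- Every `x i` kills homology, so modulo boundaries each cycle is a cycle `b` killed by all `x i ^
n`, with `n` uniform. Some `y ^ N` kills all such `b`. Writing `f = y ^ N • g` with `g` a cycle
makes `f` a boundary. -/
lemma exists_dLin_eq_of_nilpotent (x : Fin r → R) {X : Type u} [AddCommGroup X] [Module R X]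
    [IsArtinian R X] (p : ℕ) (y : R)
    (hnil : ∀ n, ∃ N, ∀ z : X, (∀ i, x i ^ n • z = 0) → y ^ N • z = 0)
    (hy : ∀ f ∈ cyc x X p, ∃ g ∈ cyc x X p, y • g = f) (f : Idx r p → X) (hf : f ∈ cyc x X p) :
    ∃ g, dLin x X p g = f := by
  obtain ⟨n, hn⟩ := exists_sub_mem_of_smul_mem x (cyc x X p) (LinearMap.range (dLin x X p))
    (fun j f hf => ⟨wedge (R := R) j f, dLin_wedge x j f hf⟩)
  obtain ⟨N, hN⟩ := hnil n
  have hyN : ∀ N, ∃ g ∈ cyc x X p, y ^ N • g = f := by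
    intro N
    induction N with
    | zero => exact ⟨f, hf, by simp⟩
    | succ N ih =>
      obtain ⟨g, hg, hgf⟩ := ih
      obtain ⟨g', hg', hgg'⟩ := hy g hg
      exact ⟨g', hg', by rw [pow_succ, mul_smul, hgg', hgf]⟩
  obtain ⟨g, hg, rfl⟩ := hyN N
  obtain ⟨b, -, hgb, hb⟩ := hn g hg
  have h0 : y ^ N • b = 0 := by
    funext s
    exact hN (b s) fun i => congrFun (hb i) s
  have := (LinearMap.range (dLin x X p)).smul_mem (y ^ N) hgb
  rwa [smul_sub, h0, sub_zero] at this

/-- If `y₁, …, y_k` is a coregular sequence of elements that are nilpotent on the `0 :_X (xᵢⁿ)`,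
then the Koszul complex of `x` on `X` is exact in degrees below `k`. -/
lemma exists_dLin_eq_of_isCoregularSeq (x : Fin r → R) (k : ℕ) :
    ∀ (X : Type u) [AddCommGroup X] [Module R X] [IsArtinian R X] (y : Fin k → R),
      IsCoregularSeq X y →
      (∀ j n, ∃ N, ∀ z : X, (∀ i, x i ^ n • z = 0) → y j ^ N • z = 0) →
      ∀ p < k, ∀ f ∈ cyc x X p, ∃ g, dLin x X p g = f := by
  induction k with
  | zero => intro X _ _ _ y _ _ p hp; omega
  | succ k ih =>
    intro X _ _ _ y hy hnil p hp
    have hsurj : ∀ z : X, ∃ w, y 0 • w = z := fun z =>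
      (((isCoregularSeq_iff X y).1 hy) 0 z (by simp)).imp fun _ h => h.2
    choose u hu using hsurj
    intro f hf
    refine exists_dLin_eq_of_nilpotent x p (y 0) (hnil 0) ?_ f hf
    intro f hf
    have hlift : y 0 • (fun s => u (f s)) = f := funext fun s => hu (f s)
    cases p with
    | zero => exact ⟨fun s => u (f s), trivial, hlift⟩
    | succ q =>
      set g : Idx r (q + 1) → X := fun s => u (f s)
      let X' := Submodule.torsionBy R X (y 0)
      have hcoe : ∀ p (h : Idx r (p + 1) → X') (s : Idx r p),
          ((dLin x X' p h s : X') : X) = dLin x X p (fun s => (h s : X)) s := by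
        intro p h s
        simp [dLin]
      -- The boundary of the lift `g` is a cycle with values in `0 :_X y₀`, one degree lower, where
      -- the shorter sequence applies. Subtracting a chain with values in `0 :_X y₀` turns `g` into
      -- a cycle without changing `y 0 • g`.
      have hdg : y 0 • dLin x X q g = 0 := by
        rw [← map_smul, hlift]
        exact hf
      let e : Idx r q → X' := fun s => ⟨dLin x X q g s, congrFun hdg s⟩
      have he : e ∈ cyc x X' q := by
        have h1 := dLin_mem_cyc x g
        cases q with
        | zero => trivial
        | succ q =>
          refine LinearMap.mem_ker.2 (funext fun s => Subtype.ext ?_)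
          rw [hcoe]
          exact congrFun (LinearMap.mem_ker.1 h1) s
      obtain ⟨h, hh⟩ := ih X' (fun i => y i.succ) hy.tail (fun j n =>
        (hnil j.succ n).imp fun N hN z hz => Subtype.ext
          (hN z.1 fun i => congrArg Subtype.val (hz i))) q (by omega) e he
      refine ⟨g - fun s => (h s : X), ?_, ?_⟩
      · refine LinearMap.mem_ker.2 ?_
        rw [map_sub, sub_eq_zero]
        funext s
        rw [← hcoe, hh]
      · rw [smul_sub, hlift, sub_eq_self]
        funext s
        exact (h s).2

/-- Exactness just below the top degree. -/
lemma exists_smul_eq_of_exact {p : ℕ} (x : Fin (p + 1) → R) {X : Type u} [AddCommGroup X]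
    [Module R X] (hex : ∀ f ∈ cyc x X p, ∃ g, dLin x X p g = f) (j : Fin (p + 1)) (z : X)
    (hz : ∀ i ≠ j, x i • z = 0) : ∃ w : X, (∀ i ≠ j, x i • w = 0) ∧ x j • w = z := by
  -- The chain `z e_s` with `s` the complement of `j`. If it bounds `g e_top`, its coefficients say
  -- that `x j • g` is `z` up to sign and that the other `x i` kill `g`.
  let f : Idx (p + 1) p → X := fun s => if j ∈ s.1 then 0 else z
  have hcard : ∀ s : Idx (p + 1) p, ∀ i ∉ s.1, s.1 = Finset.univ.erase i := by
    intro s i hi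
    refine Finset.eq_of_subset_of_card_le (fun k hk => ?_) ?_
    · exact Finset.mem_erase.2 ⟨fun h => hi (h ▸ hk), Finset.mem_univ _⟩
    · rw [Finset.card_erase_of_mem (Finset.mem_univ _), s.2]
      simp
  have hf : f ∈ cyc x X p := by
    cases p with
    | zero => trivial
    | succ q =>
      refine LinearMap.mem_ker.2 (funext fun s => ?_)
      change ∑ i : {i // i ∉ s.1}, (sgn s.1 i.1 * x i.1) • f (s.insert i) = 0
      refine Finset.sum_eq_zero fun i _ => ?_
      by_cases hji : j ∈ (s.insert i).1
      · simp only [f, if_pos hji, smul_zero]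
      · simp only [f, if_neg hji]
        rw [mul_smul, hz i.1, smul_zero]
        rintro rfl
        exact hji (Finset.mem_insert_self _ _)
  obtain ⟨g, hg⟩ := hex f hf
  have hval : ∀ i, (sgn (Finset.univ.erase i) i * x i) • g (Idx.top _) =
      if i = j then z else 0 := by
    intro i
    have h1 := dLin_top_erase X x g i ⟨Finset.univ.erase i, by simp⟩ rfl
    rw [← h1, hg]
    by_cases h : i = j
    · simp [f, h]
    · simp [f, h, Ne.symm h]
  refine ⟨(sgn (Finset.univ.erase j) j : R) • g (Idx.top _), fun i hi => ?_, ?_⟩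
  · have h1 := congrArg (fun z => (sgn (Finset.univ.erase i) i : R) • z) (hval i)
    simp only [if_neg hi, smul_zero, ← mul_smul, ← mul_assoc, sgn_mul_self, one_mul] at h1
    rw [smul_comm, h1, smul_zero]
  · rw [← mul_smul, mul_comm, hval j, if_pos rfl]

end KoszulComplex

/-! ### Coregularity in any order, and the final isomorphism. -/

open KoszulComplex

/-- In an Artinian module with a coregular sequence of length at least `d`, every system of `d`
elements of the maximal ideal with finite length `0 :_X x` is coregular in any order. -/
lemma isStronglyCoregular_of_isCoregularSeq {R : Type u} [CommRing R] [IsLocalRing R]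
    [IsNoetherianRing R] (X : Type u) [AddCommGroup X] [Module R X] [IsArtinian R X]
    {d n : ℕ} (hdn : d ≤ n) (y : Fin n → R) (hym : ∀ i, y i ∈ IsLocalRing.maximalIdeal R)
    (hy : IsCoregularSeq X y) (x : Fin d → R) (hx : ∀ i, x i ∈ IsLocalRing.maximalIdeal R)
    (hfin : IsFiniteLength R (Submodule.torsionBySet R X (Set.range x))) :
    IsStronglyCoregular x X := by
  obtain ⟨_, _⟩ := isFiniteLength_iff_isNoetherian_isArtinian.1 hfin
  obtain ⟨N, hN⟩ := exists_maximalIdeal_pow_smul_eq_zero (R := R)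
    (X := Submodule.torsionBySet R X (Set.range x))
  have hN' : ∀ j, ∀ z : X, (∀ i, x i • z = 0) → y j ^ N • z = 0 := fun j z hz =>
    congrArg Subtype.val (hN (y j ^ N) (Ideal.pow_mem_pow (hym j) N)
      ⟨z, (Submodule.mem_torsionBySet_iff _ _).2 (by
        rintro ⟨_, i, rfl⟩
        exact hz i)⟩)
  intro S j hj z hz
  cases d with
  | zero => exact j.elim0
  | succ p =>
    obtain ⟨k, hk⟩ := exists_maximalIdeal_pow_smul_eq_zero_of_isArtinian (R := R) z
    -- Outside `S ∪ {j}` nothing kills `z` a priori, so those elements are replaced by `k`-th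
    -- powers, which do.
    let e : Fin (p + 1) → ℕ := fun i => if i ∈ S ∨ i = j then 1 else k
    have hex := exists_dLin_eq_of_isCoregularSeq (fun i => x i ^ e i) n X y hy (fun l m => by
      obtain ⟨M, hM⟩ := exists_pow_smul_eq_zero_of_torsion x (y l) N (hN' l) ((k + 1) * m)
      refine ⟨M, fun z hz => hM z fun i => ?_⟩
      have hle : e i ≤ k + 1 := by
        dsimp only [e]
        split_ifs <;> omega
      rw [← Nat.sub_add_cancel hle, add_mul, pow_add, mul_smul, pow_mul (x i) (e i), hz i,
        smul_zero]) p (by omega)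
    obtain ⟨w, hw, hwz⟩ := exists_smul_eq_of_exact _ hex j z (by
      intro i hi
      by_cases hiS : i ∈ S
      · simpa [e, hiS] using hz i hiS
      · simpa [e, hiS, hi] using hk _ (Ideal.pow_mem_pow (hx i) k))
    refine ⟨w, fun i hi => ?_, by simpa [e] using hwz⟩
    have hij : i ≠ j := fun h => hj (h ▸ hi)
    simpa [e, hi] using hw i hij

lemma exists_isCoregularSeq_of_le_moduleWidth {R : Type u} [CommRing R] [IsLocalRing R]
    (X : Type u) [AddCommGroup X] [Module R X] (d : ℕ) (h : (d : ℕ∞) ≤ moduleWidth R X) :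
    ∃ (n : ℕ) (y : Fin n → R), d ≤ n ∧ (∀ i, y i ∈ IsLocalRing.maximalIdeal R) ∧
      IsCoregularSeq X y := by
  cases d with
  | zero => exact ⟨0, Fin.elim0, le_rfl, fun i => i.elim0, fun i => i.elim0⟩
  | succ d =>
    -- A strict inequality yields a sequence longer than `d` without knowing that the supremum is
    -- attained.
    have h1 : (d : ℕ∞) < moduleWidth R X := lt_of_lt_of_le (by exact_mod_cast Nat.lt_succ_self d) h
    obtain ⟨_, ⟨n, y, hym, hy, rfl⟩, hn⟩ := lt_sSup_iff.1 h1
    exact ⟨n, y, by exact_mod_cast hn, hym, hy⟩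

theorem theorem3p4 {R : Type u} [CommRing R] [IsLocalRing R] [IsNoetherianRing R]
    (X : Type u) [AddCommGroup X] [Module R X] [IsArtinian R X]
    (d : ℕ) (hdim : nDim R X = (d : WithBot ℕ∞)) (hX : IsCoCohenMacaulay R X)
    (x : Fin d → R) (hx : ∀ i, x i ∈ IsLocalRing.maximalIdeal R)
    (hfin : IsFiniteLength R (Submodule.torsionBySet R X (Set.range x))) :
    Nonempty ((localCohomology (Ideal.span (Set.range x)) d).obj (localHomology x X d) ≅
      ModuleCat.of R X) := by
  have hwidth : (d : ℕ∞) = moduleWidth R X := by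
    have h := hX.2
    rw [hdim] at h
    exact_mod_cast h.symm
  obtain ⟨n, y, hdn, hym, hy⟩ := exists_isCoregularSeq_of_le_moduleWidth X d hwidth.le
  have hsc := isStronglyCoregular_of_isCoregularSeq X hdn y hym hy x hx hfin
  have hJ : Ideal.span (Set.range x) ≤ IsLocalRing.maximalIdeal R :=
    Ideal.span_le.2 (by
      rintro _ ⟨i, rfl⟩
      exact hx i)
  obtain ⟨e₁⟩ := nonempty_localHomology_iso_torsionTower X x
  obtain ⟨e₂⟩ := nonempty_localCohomology_torsionTower (Ideal.span (Set.range x)) d X x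
    (fun i => Ideal.subset_span ⟨i, rfl⟩) hsc 0
  rw [zero_add] at e₂
  obtain ⟨e₃⟩ := nonempty_localCohomology_zero (Ideal.span (Set.range x)) X (fun z =>
    (exists_maximalIdeal_pow_smul_eq_zero_of_isArtinian (R := R) z).imp fun n hn a ha =>
      hn a (Ideal.pow_right_mono hJ n ha))
  exact ⟨(localCohomology _ d).mapIso e₁ ≪≫ e₂ ≪≫ e₃⟩
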